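/- For $k\in\mathbb{Z}_{\ge 0}$ let $(s)_k=s(s+1)\cdots(s+k-1)$. Let $D=\{(x,y)\in\mathbb{C}^2 : x\notin[1,\infty),\ y\notin(-\infty,0]\}$. Olsson's function $F_P(a,b_1,b_2,c_1,c_2;x,y)$ is the analytic continuation to $D$ (if it exists) of the double power series $$\sum_{i,j=0}^{\infty}\frac{(a)_{i+j}\,(a-c_2+1)_i\,(b_1)_i\,(b_2)_j}{(a+b_2-c_2+1)_{i+j}\,(c_1)_i\,i!\,j!}\,x^i(1-y)^j ,\qquad |x|<1,\ |1-y|<1 .$$ All complex powers below are principal values. Let $a,b,c,d,e\in\mathbb{C}$ with $\operatorname{Re}a,\ \operatorname{Re}d,\ \operatorname{Re}(a+c),\ \operatorname{Re}(a+d),\ \operatorname{Re}(e-a-d)>0$, and let $x,y\in\mathbb{C}$ with $x\notin[1,\infty)$ and $y\notin[0,\infty)$. Then $F_P(a+c,b,c,e,c-d+1;\cdot,\cdot)$ exists on $D$ (the series above converges absolutely for $|x|<1$, $|1-y|<1$ and has an analytic continuation to $D$), the three double integrals below converge absolutely, and $$\frac{\Gamma(a+c)\Gamma(a+d)}{\Gamma(a+c+d)\Gamma(a)}\,(-y)^{-c}\,F_P(a+c,b,c,e,c-d+1;x,-y^{-1})$$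 is equal to each of $$\frac{\Gamma(e)}{\Gamma(e-a-d)\Gamma(a)\Gamma(d)}\int_0^1\!\!\int_0^1 u^{a-1}(1-u)^{e-a-1}v^{d-1}(1-v)^{e-a-d-1}(1-ux)^{-b}\bigl(1-(1-u)u^{-1}vy\bigr)^{-c}\,du\,dv,$$ $$\frac{\Gamma(e)}{\Gamma(e-a-d)\Gamma(a)\Gamma(d)}\int_{u=0}^1\int_{v=0}^{u^{-1}-1} u^{a+d-1}(1-ux)^{-b}v^{d-1}(1-vy)^{-c}(1-u-uv)^{e-a-d-1}\,dv\,du,$$ $$\frac{\Gamma(e)}{\Gamma(e-a-d)\Gamma(a)\Gamma(d)}\int_{u=0}^1\int_{v=0}^{1-u} u^{a-1}(1-ux)^{-b}v^{d-1}(1-u^{-1}vy)^{-c}(1-u-v)^{e-a-d-1}\,dv\,du .$$ -/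

import Mathlib

open MeasureTheory

noncomputable section

/-- The domain `x ∉ [1, ∞)`, `y ∉ (-∞, 0]` in `ℂ²` (a product of two slit planes). -/
def olssonDomain : Set (ℂ × ℂ) :=
  {p | p.1 ∉ Complex.ofReal '' Set.Ici (1 : ℝ) ∧ p.2 ∉ Complex.ofReal '' Set.Iic (0 : ℝ)}

/-- The `(i, j)` term of the double power series of Olsson's function
`F_P(a, b₁, b₂, c₁, c₂; x, y)`, in powers of `x` and `1 - y`. Here
`(ascPochhammer ℂ k).eval s` is the Pochhammer symbol `(s)_k = s (s + 1) ⋯ (s + k - 1)`. -/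
def olssonTerm (a b₁ b₂ c₁ c₂ x y : ℂ) (p : ℕ × ℕ) : ℂ :=
  ((ascPochhammer ℂ (p.1 + p.2)).eval a * (ascPochhammer ℂ p.1).eval (a - c₂ + 1) *
      (ascPochhammer ℂ p.1).eval b₁ * (ascPochhammer ℂ p.2).eval b₂) /
    ((ascPochhammer ℂ (p.1 + p.2)).eval (a + b₂ - c₂ + 1) * (ascPochhammer ℂ p.1).eval c₁ *
      (p.1.factorial : ℂ) * (p.2.factorial : ℂ)) * x ^ p.1 * (1 - y) ^ p.2

/-- `F` is the analytic continuation to `olssonDomain` of the sum of the double power series,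
which converges absolutely for `|x| < 1`, `|1 - y| < 1`. Since `olssonDomain` is open, connected
and contains that bidisc, `F` is determined on `olssonDomain`. -/
def IsOlssonFP (a b₁ b₂ c₁ c₂ : ℂ) (F : ℂ × ℂ → ℂ) : Prop :=
  DifferentiableOn ℂ F olssonDomain ∧
    ∀ x y : ℂ, ‖x‖ < 1 → ‖1 - y‖ < 1 → HasSum (olssonTerm a b₁ b₂ c₁ c₂ x y) (F (x, y))

open Classical in
/-- Olsson's function `F_P(a, b₁, b₂, c₁, c₂; x, y)` on `olssonDomain`: the analytic continuation
of its double power series (the value `0` is used if there is no such continuation). -/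
def olssonFP (a b₁ b₂ c₁ c₂ x y : ℂ) : ℂ :=
  if h : ∃ F : ℂ × ℂ → ℂ, IsOlssonFP a b₁ b₂ c₁ c₂ F then h.choose (x, y) else 0

/-- The integrand of the double integral over the unit square. -/
def squareIntegrand (a b c d e x y : ℂ) (u v : ℝ) : ℂ :=
  (u : ℂ) ^ (a - 1) * (1 - (u : ℂ)) ^ (e - a - 1) * (v : ℂ) ^ (d - 1) *
    (1 - (v : ℂ)) ^ (e - a - d - 1) * (1 - (u : ℂ) * x) ^ (-b) *
    (1 - (1 - (u : ℂ)) * (u : ℂ)⁻¹ * (v : ℂ) * y) ^ (-c)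

/-- The integrand of the double integral over `0 < u < 1`, `0 < v < 1 / u - 1`. -/
def hyperbolaIntegrand (a b c d e x y : ℂ) (u v : ℝ) : ℂ :=
  (u : ℂ) ^ (a + d - 1) * (1 - (u : ℂ) * x) ^ (-b) * (v : ℂ) ^ (d - 1) *
    (1 - (v : ℂ) * y) ^ (-c) * (1 - (u : ℂ) - (u : ℂ) * (v : ℂ)) ^ (e - a - d - 1)

/-- The integrand of the double integral over the triangle `0 < u < 1`, `0 < v < 1 - u`. -/
def triangleIntegrand (a b c d e x y : ℂ) (u v : ℝ) : ℂ :=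
  (u : ℂ) ^ (a - 1) * (1 - (u : ℂ) * x) ^ (-b) * (v : ℂ) ^ (d - 1) *
    (1 - (u : ℂ)⁻¹ * (v : ℂ) * y) ^ (-c) * (1 - (u : ℂ) - (v : ℂ)) ^ (e - a - d - 1)

end

/-! With `s, t` the coordinates on the unit square, everything rests on the Euler integral
`olssonEuler`, whose weight is `s^(a+d-1) (1-s)^(e-a-d-1) t^(a+c-1) (1-t)^(d-1)` and whose kernel is
`(1-stx)^(-b) (1-t(1-y))^(-c)`. On the bidisc, expand both kernel factors in binomial series and
integrate termwise: `t^(i+j)` yields `(a+c)_{i+j}/(a+c+d)_{i+j}` and `s^i` yields `(a+d)_i/(e)_i`,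
which is the defining series (`hasSum_olssonTerm`). The integral is holomorphic on the whole domain
because slit planes are star-shaped, so it is the continuation (`isOlssonFP_olssonEuler`), and the
identity theorem makes it the only one (`isOlssonFP_unique`).

At `-1/y`, the factor `(-y)^(-c)` turns `(1-t(1+1/y))^(-c)` into `t^(-c) (1-(1-t)y/t)^(-c)`; the
point is that no branch cut is crossed (`neg_cpow_mul_cpow`). The substitution `u = st`, `v =
s(1-t)` then gives the triangle integral, and rescaling `v` by `u` or by `1-u` relates the triangle
to the hyperbolic region and to the square. Each substitution also transfers absolute convergence.
-/

/-! ### Beta integrals, Pochhammer symbols and the binomial series. -/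

/-- The integrand of the Beta integral. -/
noncomputable def betaDensity (u v : ℂ) (x : ℝ) : ℂ :=
  (x : ℂ) ^ (u - 1) * (1 - (x : ℂ)) ^ (v - 1)

lemma integrableOn_betaDensity {u v : ℂ} (hu : 0 < u.re) (hv : 0 < v.re) :
    IntegrableOn (betaDensity u v) (Set.Ioo 0 1) :=
  ((intervalIntegrable_iff_integrableOn_Ioo_of_le zero_le_one).1
    (Complex.betaIntegral_convergent hu hv))

lemma setIntegral_betaDensity {u v : ℂ} (hu : 0 < u.re) (hv : 0 < v.re) :
    ∫ x in Set.Ioo (0 : ℝ) 1, betaDensity u v x =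
      Complex.Gamma u * Complex.Gamma v / Complex.Gamma (u + v) := by
  rw [Complex.Gamma_mul_Gamma_eq_betaIntegral hu hv, mul_div_cancel_left₀,
    Complex.betaIntegral, intervalIntegral.integral_of_le zero_le_one, integral_Ioc_eq_integral_Ioo]
  · rfl
  · exact Complex.Gamma_ne_zero_of_re_pos (by simpa using add_pos hu hv)

lemma betaDensity_add_nat (u v : ℂ) (n : ℕ) {x : ℝ} (hx : 0 < x) :
    betaDensity (u + n) v x = betaDensity u v x * (x : ℂ) ^ n := by
  have : (x : ℂ) ≠ 0 := by exact_mod_cast hx.ne'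
  rw [betaDensity, betaDensity, add_sub_right_comm, Complex.cpow_add _ _ this,
    Complex.cpow_natCast]
  ring

lemma Gamma_add_nat_eq_ascPochhammer {s : ℂ} (hs : 0 < s.re) (n : ℕ) :
    Complex.Gamma (s + n) = (ascPochhammer ℂ n).eval s * Complex.Gamma s := by
  rw [← Complex.Gamma_add_nat_div_Gamma_eq, div_mul_cancel₀]
  · exact Complex.Gamma_ne_zero_of_re_pos hs
  · rintro k rfl
    simp at hs
    linarith [k.cast_nonneg (α := ℝ)]

lemma ascPochhammer_eval_ne_zero {s : ℂ} (hs : 0 < s.re) (n : ℕ) :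
    (ascPochhammer ℂ n).eval s ≠ 0 := by
  intro h
  have := Gamma_add_nat_eq_ascPochhammer hs n
  rw [h, zero_mul] at this
  exact Complex.Gamma_ne_zero_of_re_pos (by simp; positivity) this

lemma hasSum_one_sub_cpow_neg (b : ℂ) {z : ℂ} (hz : ‖z‖ < 1) :
    HasSum (fun n : ℕ => (ascPochhammer ℂ n).eval b / (n.factorial : ℂ) * z ^ n)
      ((1 - z) ^ (-b)) := by
  have h := (Complex.one_div_one_sub_cpow_hasFPowerSeriesOnBall_zero b).hasSum
    (y := z) (by simpa [enorm_eq_nnnorm, ← NNReal.coe_lt_coe] using! hz)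
  simp only [FormalMultilinearSeries.ofScalars_apply_eq, zero_add, smul_eq_mul, one_div] at h
  rw [Complex.cpow_neg]
  refine (congrArg (HasSum · _) (funext fun n => ?_)).mpr h
  -- The `Ring.choose` coefficient unfolds to `Ring.multichoose b n`, which is the Pochhammer symbol
  -- over `n!`.
  have h1 := Ring.factorial_nsmul_multichoose_eq_ascPochhammer b n
  rw [Polynomial.ascPochhammer_smeval_eq_eval, nsmul_eq_mul] at h1
  rw [← h1, mul_div_cancel_left₀ _ (by exact_mod_cast n.factorial_ne_zero), Ring.choose]
  congr 2
  ring

lemma summable_norm_ascPochhammer_mul_pow (b : ℂ) {z : ℂ} (hz : ‖z‖ < 1) :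
    Summable fun n : ℕ => ‖(ascPochhammer ℂ n).eval b / (n.factorial : ℂ) * z ^ n‖ :=
  (hasSum_one_sub_cpow_neg b hz).summable.norm

/-! ### The Euler double integral and its power series. -/

/-- The open unit square. -/
def unitSquare : Set (ℝ × ℝ) := {p | 0 < p.1 ∧ p.1 < 1 ∧ 0 < p.2 ∧ p.2 < 1}

lemma unitSquare_eq_prod : unitSquare = Set.Ioo (0 : ℝ) 1 ×ˢ Set.Ioo (0 : ℝ) 1 := by
  ext p
  simp [unitSquare, and_assoc]

lemma measurableSet_unitSquare : MeasurableSet unitSquare := by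
  rw [unitSquare_eq_prod]
  exact measurableSet_Ioo.prod measurableSet_Ioo

lemma volume_restrict_unitSquare :
    (volume : Measure (ℝ × ℝ)).restrict unitSquare =
      (volume.restrict (Set.Ioo (0 : ℝ) 1)).prod (volume.restrict (Set.Ioo (0 : ℝ) 1)) := by
  rw [unitSquare_eq_prod, Measure.prod_restrict, Measure.volume_eq_prod]

/-- A product of two Beta integrands. -/
noncomputable def betaWeight (u v u' v' : ℂ) (p : ℝ × ℝ) : ℂ :=
  betaDensity u v p.1 * betaDensity u' v' p.2

lemma integrableOn_betaWeight {u v u' v' : ℂ} (hu : 0 < u.re) (hv : 0 < v.re) (hu' : 0 < u'.re)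
    (hv' : 0 < v'.re) : IntegrableOn (betaWeight u v u' v') unitSquare := by
  rw [IntegrableOn, volume_restrict_unitSquare]
  exact (integrableOn_betaDensity hu hv).mul_prod (integrableOn_betaDensity hu' hv')

lemma setIntegral_betaWeight {u v u' v' : ℂ} (hu : 0 < u.re) (hv : 0 < v.re) (hu' : 0 < u'.re)
    (hv' : 0 < v'.re) : ∫ p in unitSquare, betaWeight u v u' v' p =
      (Complex.Gamma u * Complex.Gamma v / Complex.Gamma (u + v)) *
        (Complex.Gamma u' * Complex.Gamma v' / Complex.Gamma (u' + v')) := by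
  rw [volume_restrict_unitSquare, ← setIntegral_betaDensity hu hv,
    ← setIntegral_betaDensity hu' hv']
  exact integral_prod_mul _ _

/-- The factor of the Euler type integrand of Olsson's function that depends on `(x, y)`. -/
noncomputable def eulerKernel (b c : ℂ) (q : ℂ × ℂ) (p : ℝ × ℝ) : ℂ :=
  (1 - (p.1 : ℂ) * p.2 * q.1) ^ (-b) * (1 - (p.2 : ℂ) * (1 - q.2)) ^ (-c)

/-- The terms of the double binomial expansion of `eulerKernel`. -/
noncomputable def eulerKernelTerm (b c : ℂ) (q : ℂ × ℂ) (n : ℕ × ℕ) (p : ℝ × ℝ) : ℂ :=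
  ((ascPochhammer ℂ n.1).eval b / (n.1.factorial : ℂ) * ((p.1 : ℂ) * p.2 * q.1) ^ n.1) *
    ((ascPochhammer ℂ n.2).eval c / (n.2.factorial : ℂ) * ((p.2 : ℂ) * (1 - q.2)) ^ n.2)

lemma norm_ofReal_mul_lt_one {t : ℝ} (h0 : 0 < t) (h1 : t < 1) {z : ℂ} (hz : ‖z‖ < 1) :
    ‖(t : ℂ) * z‖ < 1 := by
  rw [norm_mul, Complex.norm_of_nonneg h0.le]
  nlinarith [norm_nonneg z]

lemma hasSum_eulerKernelTerm (b c : ℂ) {q : ℂ × ℂ} (hx : ‖q.1‖ < 1) (hy : ‖1 - q.2‖ < 1)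
    {p : ℝ × ℝ} (hp : p ∈ unitSquare) :
    HasSum (fun n => eulerKernelTerm b c q n p) (eulerKernel b c q p) := by
  obtain ⟨h1, h2, h3, h4⟩ := hp
  have hX : ‖(p.1 : ℂ) * p.2 * q.1‖ < 1 := by
    rw [mul_assoc]
    exact norm_ofReal_mul_lt_one h1 h2 (norm_ofReal_mul_lt_one h3 h4 hx)
  have hY := norm_ofReal_mul_lt_one h3 h4 hy
  have hs := summable_mul_of_summable_norm (summable_norm_ascPochhammer_mul_pow b hX)
    (summable_norm_ascPochhammer_mul_pow c hY)
  have h := (hasSum_one_sub_cpow_neg b hX).mul (hasSum_one_sub_cpow_neg c hY) hs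
  simp only [eulerKernelTerm, eulerKernel]
  exact h

/-- The bound does not depend on the integration point and is summable over `n` on the bidisc, which
permits termwise integration. -/
lemma norm_eulerKernelTerm_le (b c : ℂ) (q : ℂ × ℂ) (n : ℕ × ℕ) {p : ℝ × ℝ}
    (hp : p ∈ unitSquare) : ‖eulerKernelTerm b c q n p‖ ≤
      ‖(ascPochhammer ℂ n.1).eval b / (n.1.factorial : ℂ) * q.1 ^ n.1‖ *
        ‖(ascPochhammer ℂ n.2).eval c / (n.2.factorial : ℂ) * (1 - q.2) ^ n.2‖ := by
  obtain ⟨h1, h2, h3, h4⟩ := hp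
  rw [eulerKernelTerm, norm_mul]
  have key (t : ℝ) (h0 : 0 < t) (ht : t < 1) (w z : ℂ) (n : ℕ) :
      ‖w * ((t : ℂ) * z) ^ n‖ ≤ ‖w * z ^ n‖ := by
    rw [norm_mul, norm_mul, norm_pow, norm_pow, norm_mul, Complex.norm_of_nonneg h0.le]
    gcongr
    nlinarith [norm_nonneg z]
  gcongr
  · have h := key (p.1 * p.2) (by positivity) (by nlinarith)
      ((ascPochhammer ℂ n.1).eval b / (n.1.factorial : ℂ)) q.1 n.1
    rwa [Complex.ofReal_mul] at h
  · exact key p.2 h3 h4 _ _ _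

lemma continuous_eulerKernelTerm (b c : ℂ) (q : ℂ × ℂ) (n : ℕ × ℕ) :
    Continuous (eulerKernelTerm b c q n) := by
  unfold eulerKernelTerm
  fun_prop

/-- Monomials only shift the first parameter of each Beta weight, so every term integrates to Gamma
functions. -/
lemma betaWeight_mul_eulerKernelTerm (u v u' v' b c : ℂ) (q : ℂ × ℂ) (n : ℕ × ℕ) {p : ℝ × ℝ}
    (hp : p ∈ unitSquare) : betaWeight u v u' v' p * eulerKernelTerm b c q n p =
      ((ascPochhammer ℂ n.1).eval b / (n.1.factorial : ℂ) * q.1 ^ n.1 *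
        ((ascPochhammer ℂ n.2).eval c / (n.2.factorial : ℂ) * (1 - q.2) ^ n.2)) *
          betaWeight (u + n.1) v (u' + (n.1 + n.2 : ℕ)) v' p := by
  rw [betaWeight, betaWeight, betaDensity_add_nat _ _ _ hp.1, betaDensity_add_nat _ _ _ hp.2.2.1,
    eulerKernelTerm]
  simp only [mul_pow, pow_add]
  ring

/-- The prefactor of the Euler type integral of Olsson's function. -/
noncomputable def eulerConst (a c d e : ℂ) : ℂ :=
  (Complex.Gamma (a + c + d) / (Complex.Gamma (a + c) * Complex.Gamma d)) *
    (Complex.Gamma e / (Complex.Gamma (a + d) * Complex.Gamma (e - a - d)))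

/-- The Euler type double integral for `F_P(a + c, b, c, e, c - d + 1; x, y)`. -/
noncomputable def olssonEuler (a b c d e : ℂ) (q : ℂ × ℂ) : ℂ :=
  eulerConst a c d e *
    ∫ p in unitSquare, betaWeight (a + d) (e - a - d) (a + c) d p * eulerKernel b c q p

/-- The third lower-level parameter `c - d + 1` makes the series' `a - c₂ + 1` equal to `a + d` and
its `a + b₂ - c₂ + 1` equal to `a + c + d`; `eulerConst` normalizes the term `n = (0, 0)` to `1`. -/
lemma setIntegral_eulerKernelTerm {a b c d e : ℂ} (hd : 0 < d.re) (hac : 0 < (a + c).re)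
    (had : 0 < (a + d).re) (head : 0 < (e - a - d).re) (q : ℂ × ℂ) (n : ℕ × ℕ) :
    eulerConst a c d e * ∫ p in unitSquare,
        betaWeight (a + d) (e - a - d) (a + c) d p * eulerKernelTerm b c q n p =
      olssonTerm (a + c) b c e (c - d + 1) q.1 q.2 n := by
  have he : 0 < e.re := by simp at had head; linarith
  have hacd : 0 < (a + c + d).re := by simp at hac ⊢; linarith
  rw [setIntegral_congr_fun measurableSet_unitSquare
    fun p hp => betaWeight_mul_eulerKernelTerm _ _ _ _ _ _ _ _ hp,
    integral_const_mul, setIntegral_betaWeight (by simp at had ⊢; positivity) head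
      (by simp at hac ⊢; positivity) hd,
    show a + d + n.1 + (e - a - d) = e + n.1 by ring,
    show a + c + (n.1 + n.2 : ℕ) + d = a + c + d + (n.1 + n.2 : ℕ) by ring,
    Gamma_add_nat_eq_ascPochhammer he, Gamma_add_nat_eq_ascPochhammer hacd,
    Gamma_add_nat_eq_ascPochhammer had, Gamma_add_nat_eq_ascPochhammer hac, eulerConst, olssonTerm,
    show a + c - (c - d + 1) + 1 = a + d by ring,
    show a + c + c - (c - d + 1) + 1 = a + c + d by ring]
  have h1 := Complex.Gamma_ne_zero_of_re_pos hd
  have h2 := Complex.Gamma_ne_zero_of_re_pos hac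
  have h3 := Complex.Gamma_ne_zero_of_re_pos had
  have h4 := Complex.Gamma_ne_zero_of_re_pos head
  have h5 := Complex.Gamma_ne_zero_of_re_pos he
  have h6 := Complex.Gamma_ne_zero_of_re_pos hacd
  have h7 := ascPochhammer_eval_ne_zero he n.1
  have h8 := ascPochhammer_eval_ne_zero hacd (n.1 + n.2)
  have h9 : (n.1.factorial : ℂ) ≠ 0 := by exact_mod_cast n.1.factorial_ne_zero
  have h10 : (n.2.factorial : ℂ) ≠ 0 := by exact_mod_cast n.2.factorial_ne_zero
  field_simp

lemma hasSum_olssonTerm {a b c d e : ℂ} (hd : 0 < d.re) (hac : 0 < (a + c).re)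
    (had : 0 < (a + d).re) (head : 0 < (e - a - d).re) {q : ℂ × ℂ} (hx : ‖q.1‖ < 1)
    (hy : ‖1 - q.2‖ < 1) :
    HasSum (olssonTerm (a + c) b c e (c - d + 1) q.1 q.2) (olssonEuler a b c d e q) := by
  set w := betaWeight (a + d) (e - a - d) (a + c) d
  have hw : IntegrableOn w unitSquare := integrableOn_betaWeight had head hac hd
  set B : ℕ × ℕ → ℝ := fun n =>
    ‖(ascPochhammer ℂ n.1).eval b / (n.1.factorial : ℂ) * q.1 ^ n.1‖ *
      ‖(ascPochhammer ℂ n.2).eval c / (n.2.factorial : ℂ) * (1 - q.2) ^ n.2‖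
  have hB : Summable B :=
    (summable_norm_ascPochhammer_mul_pow b hx).mul_of_nonneg
      (summable_norm_ascPochhammer_mul_pow c hy) (fun _ => norm_nonneg _) fun _ => norm_nonneg _
  have hint (n) : IntegrableOn (fun p => w p * eulerKernelTerm b c q n p) unitSquare :=
    Integrable.mul_bdd hw (continuous_eulerKernelTerm b c q n).aestronglyMeasurable
      (c := B n) ((ae_restrict_iff' measurableSet_unitSquare).2
        (.of_forall fun p hp => norm_eulerKernelTerm_le b c q n hp))
  have hle (n) : ∫ p in unitSquare, ‖w p * eulerKernelTerm b c q n p‖ ≤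
      (∫ p in unitSquare, ‖w p‖) * B n := by
    rw [← integral_mul_const]
    refine setIntegral_mono_on (hint n).norm (hw.norm.mul_const _) measurableSet_unitSquare
      fun p hp => ?_
    rw [norm_mul]
    gcongr
    exact norm_eulerKernelTerm_le b c q n hp
  have h := hasSum_integral_of_summable_integral_norm hint
    (Summable.of_nonneg_of_le (fun n => by positivity) hle (hB.mul_left _))
  have h' := h.mul_left (eulerConst a c d e)
  simp_rw [w, setIntegral_eulerKernelTerm hd hac had head q] at h'
  have hcongr : ∫ p in unitSquare, w p * eulerKernel b c q p =
      ∫ p in unitSquare, ∑' n, w p * eulerKernelTerm b c q n p :=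
    setIntegral_congr_fun measurableSet_unitSquare fun p hp =>
      ((hasSum_eulerKernelTerm b c hx hy hp).mul_left (w p)).tsum_eq.symm
  rw [olssonEuler, hcongr]
  exact h'

/-! ### Analytic continuation of the Euler integral. -/

lemma mem_olssonDomain_iff (q : ℂ × ℂ) :
    q ∈ olssonDomain ↔ 1 - q.1 ∈ Complex.slitPlane ∧ q.2 ∈ Complex.slitPlane := by
  have key (z : ℂ) : z ∉ Complex.ofReal '' Set.Iic (0 : ℝ) ↔ z ∈ Complex.slitPlane := by
    rw [Complex.mem_slitPlane_iff_not_le_zero, not_iff_not]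
    constructor
    · rintro ⟨r, hr, rfl⟩
      exact_mod_cast hr
    · intro h
      rw [Complex.le_def] at h
      exact ⟨z.re, h.1, Complex.ext rfl h.2.symm⟩
  rw [← key, ← key]
  refine and_congr (not_congr ⟨?_, ?_⟩) Iff.rfl
  · rintro ⟨r, hr, h⟩
    exact ⟨1 - r, by simpa using hr, by simp [h]⟩
  · rintro ⟨r, hr, h⟩
    refine ⟨1 - r, by simpa using hr, ?_⟩
    push_cast
    rw [h]
    ring

lemma isOpen_olssonDomain : IsOpen olssonDomain := by
  have : olssonDomain = (fun q : ℂ × ℂ => 1 - q.1) ⁻¹' Complex.slitPlane ∩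
      Prod.snd ⁻¹' Complex.slitPlane := by
    ext q
    exact mem_olssonDomain_iff q
  rw [this]
  exact (Complex.isOpen_slitPlane.preimage (by fun_prop)).inter
    (Complex.isOpen_slitPlane.preimage continuous_snd)

/-- The point lies on the segment from `1` to `z`, and the slit plane is star-shaped about `1`. -/
lemma one_sub_ofReal_mul_one_sub_mem_slitPlane {z : ℂ} (hz : z ∈ Complex.slitPlane) {t : ℝ}
    (h0 : 0 ≤ t) (h1 : t ≤ 1) : 1 - (t : ℂ) * (1 - z) ∈ Complex.slitPlane := by
  have := Complex.starConvex_one_slitPlane hz (sub_nonneg.2 h1) h0 (by ring)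
  convert this using 1
  simp
  ring

/-- The closed unit square. -/
def closedUnitSquare : Set (ℝ × ℝ) := Set.Icc 0 1

lemma unitSquare_subset_closedUnitSquare : unitSquare ⊆ closedUnitSquare :=
  fun _ ⟨h1, h2, h3, h4⟩ => ⟨⟨h1.le, h3.le⟩, ⟨h2.le, h4.le⟩⟩

/-- Holding up to the boundary of the square, this keeps the kernel continuous on a compact set,
hence bounded; only the weight is singular there. -/
lemma eulerKernel_bases_mem_slitPlane {q : ℂ × ℂ} (hq : q ∈ olssonDomain) {p : ℝ × ℝ}
    (hp : p ∈ closedUnitSquare) :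
    1 - (p.1 : ℂ) * p.2 * q.1 ∈ Complex.slitPlane ∧
      1 - (p.2 : ℂ) * (1 - q.2) ∈ Complex.slitPlane := by
  obtain ⟨⟨h1, h3⟩, ⟨h2, h4⟩⟩ := hp
  simp only [Prod.fst_zero, Prod.snd_zero, Prod.fst_one, Prod.snd_one] at h1 h2 h3 h4
  obtain ⟨hx, hy⟩ := (mem_olssonDomain_iff q).1 hq
  refine ⟨?_, one_sub_ofReal_mul_one_sub_mem_slitPlane hy h3 h4⟩
  have := one_sub_ofReal_mul_one_sub_mem_slitPlane hx (mul_nonneg h1 h3)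
    (mul_le_one₀ h2 h3 h4)
  simpa using this

/-- The derivative of `eulerKernel` in `(x, y)`. -/
noncomputable def eulerKernelDeriv (b c : ℂ) (q : ℂ × ℂ) (p : ℝ × ℝ) : ℂ × ℂ →L[ℂ] ℂ :=
  (b * ((p.1 : ℂ) * p.2) * (1 - (p.1 : ℂ) * p.2 * q.1) ^ (-b - 1) *
      (1 - (p.2 : ℂ) * (1 - q.2)) ^ (-c)) • ContinuousLinearMap.fst ℂ ℂ ℂ +
    (-c * p.2 * (1 - (p.2 : ℂ) * (1 - q.2)) ^ (-c - 1) *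
      (1 - (p.1 : ℂ) * p.2 * q.1) ^ (-b)) • ContinuousLinearMap.snd ℂ ℂ ℂ

lemma hasFDerivAt_eulerKernel (b c : ℂ) {q : ℂ × ℂ} (hq : q ∈ olssonDomain) {p : ℝ × ℝ}
    (hp : p ∈ closedUnitSquare) :
    HasFDerivAt (fun q => eulerKernel b c q p) (eulerKernelDeriv b c q p) q := by
  obtain ⟨hX, hY⟩ := eulerKernel_bases_mem_slitPlane hq hp
  have h1 : HasFDerivAt (fun q : ℂ × ℂ => 1 - (p.1 : ℂ) * p.2 * q.1)
      (-(((p.1 : ℂ) * p.2) • ContinuousLinearMap.fst ℂ ℂ ℂ)) q :=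
    (hasFDerivAt_fst.const_mul _).const_sub _
  have h2 : HasFDerivAt (fun q : ℂ × ℂ => 1 - (p.2 : ℂ) * (1 - q.2))
      (-((p.2 : ℂ) • -ContinuousLinearMap.snd ℂ ℂ ℂ)) q :=
    ((hasFDerivAt_snd.const_sub _).const_mul _).const_sub _
  have h :=
    ((Complex.hasStrictDerivAt_cpow_const (c := -b) hX).hasDerivAt.comp_hasFDerivAt q h1).mul
    ((Complex.hasStrictDerivAt_cpow_const (c := -c) hY).hasDerivAt.comp_hasFDerivAt q h2)
  refine h.congr_fderiv ?_
  refine ContinuousLinearMap.ext fun z => ?_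
  simp [eulerKernelDeriv]
  ring

lemma continuousOn_eulerKernel (b c : ℂ) :
    ContinuousOn (fun r : (ℂ × ℂ) × (ℝ × ℝ) => eulerKernel b c r.1 r.2)
      (olssonDomain ×ˢ closedUnitSquare) := by
  have h1 := fun r (hr : r ∈ olssonDomain ×ˢ closedUnitSquare) =>
    eulerKernel_bases_mem_slitPlane hr.1 hr.2
  exact ((by fun_prop : Continuous fun r : (ℂ × ℂ) × (ℝ × ℝ) =>
      1 - (r.2.1 : ℂ) * r.2.2 * r.1.1).continuousOn.cpow_const fun r hr => (h1 r hr).1).mul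
    ((by fun_prop : Continuous fun r : (ℂ × ℂ) × (ℝ × ℝ) =>
      1 - (r.2.2 : ℂ) * (1 - r.1.2)).continuousOn.cpow_const fun r hr => (h1 r hr).2)

lemma continuousOn_eulerKernelDeriv (b c : ℂ) :
    ContinuousOn (fun r : (ℂ × ℂ) × (ℝ × ℝ) => eulerKernelDeriv b c r.1 r.2)
      (olssonDomain ×ˢ closedUnitSquare) := by
  have h1 := fun r (hr : r ∈ olssonDomain ×ˢ closedUnitSquare) =>
    eulerKernel_bases_mem_slitPlane hr.1 hr.2
  have hX (s : ℂ) := (by fun_prop : Continuous fun r : (ℂ × ℂ) × (ℝ × ℝ) =>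
      1 - (r.2.1 : ℂ) * r.2.2 * r.1.1).continuousOn.cpow_const (b := s) fun r hr => (h1 r hr).1
  have hY (s : ℂ) := (by fun_prop : Continuous fun r : (ℂ × ℂ) × (ℝ × ℝ) =>
      1 - (r.2.2 : ℂ) * (1 - r.1.2)).continuousOn.cpow_const (b := s) fun r hr => (h1 r hr).2
  have h2 := ((by fun_prop : Continuous fun r : (ℂ × ℂ) × (ℝ × ℝ) =>
      b * ((r.2.1 : ℂ) * r.2.2)).continuousOn.mul (hX (-b - 1))).mul (hY (-c))
  have h3 := ((by fun_prop : Continuous fun r : (ℂ × ℂ) × (ℝ × ℝ) =>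
      -c * (r.2.2 : ℂ)).continuousOn.mul (hY (-c - 1))).mul (hX (-b))
  exact (h2.smul continuousOn_const).add (h3.smul continuousOn_const)

/-- A function of `(q, p)` that is continuous on `olssonDomain ×ˢ closedUnitSquare` is
continuous in `p`, and bounded for `q` in a neighbourhood of a point. -/
lemma exists_bound_near {E : Type*} [NormedAddCommGroup E] {f : ℂ × ℂ → ℝ × ℝ → E}
    (hf : ContinuousOn (fun r : (ℂ × ℂ) × (ℝ × ℝ) => f r.1 r.2) (olssonDomain ×ˢ closedUnitSquare))
    {q : ℂ × ℂ} (hq : q ∈ olssonDomain) :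
    ∃ ε > 0, ∃ C, Metric.ball q ε ⊆ olssonDomain ∧
      ∀ q' ∈ Metric.ball q ε, ∀ p ∈ closedUnitSquare, ‖f q' p‖ ≤ C := by
  obtain ⟨ε, hε, hsub⟩ := Metric.nhds_basis_closedBall.mem_iff.1 (isOpen_olssonDomain.mem_nhds hq)
  obtain ⟨C, hC⟩ := ((isCompact_closedBall q ε).prod
    (isCompact_Icc : IsCompact closedUnitSquare)).exists_bound_of_continuousOn
    (hf.mono (Set.prod_mono hsub subset_rfl))
  exact ⟨ε, hε, C, Metric.ball_subset_closedBall.trans hsub, fun q' hq' p hp =>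
    hC (q', p) ⟨Metric.ball_subset_closedBall hq', hp⟩⟩

lemma aestronglyMeasurable_unitSquare_of_continuousOn {E : Type*} [NormedAddCommGroup E]
    [SecondCountableTopology E] {f : ℂ × ℂ → ℝ × ℝ → E}
    (hf : ContinuousOn (fun r : (ℂ × ℂ) × (ℝ × ℝ) => f r.1 r.2) (olssonDomain ×ˢ closedUnitSquare))
    {q : ℂ × ℂ} (hq : q ∈ olssonDomain) :
    AEStronglyMeasurable (f q) (volume.restrict unitSquare) :=
  (hf.comp (f := fun p => (q, p)) (by fun_prop) fun p hp =>
    ⟨hq, unitSquare_subset_closedUnitSquare hp⟩).aestronglyMeasurable measurableSet_unitSquare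

lemma integrableOn_mul_eulerKernel {w : ℝ × ℝ → ℂ} (hw : IntegrableOn w unitSquare) (b c : ℂ)
    {q : ℂ × ℂ} (hq : q ∈ olssonDomain) :
    IntegrableOn (fun p => w p * eulerKernel b c q p) unitSquare := by
  obtain ⟨ε, hε, C, -, hC⟩ := exists_bound_near (continuousOn_eulerKernel b c) hq
  exact Integrable.mul_bdd hw
    (aestronglyMeasurable_unitSquare_of_continuousOn (continuousOn_eulerKernel b c) hq) (c := C)
    ((ae_restrict_iff' measurableSet_unitSquare).2 (.of_forall fun p hp =>
      hC q (Metric.mem_ball_self hε) p (unitSquare_subset_closedUnitSquare hp)))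

/-- Differentiation under the integral sign, dominated locally by a constant multiple of `‖w‖`. -/
lemma differentiableOn_integral_mul_eulerKernel {w : ℝ × ℝ → ℂ} (hw : IntegrableOn w unitSquare)
    (b c : ℂ) : DifferentiableOn ℂ (fun q => ∫ p in unitSquare, w p * eulerKernel b c q p)
      olssonDomain := by
  intro q hq
  obtain ⟨ε, hε, C, hsub, hC⟩ := exists_bound_near (continuousOn_eulerKernelDeriv b c) hq
  refine HasFDerivAt.differentiableAt (f' := ∫ p in unitSquare, w p • eulerKernelDeriv b c q p)
    ?_ |>.differentiableWithinAt
  refine hasFDerivAt_integral_of_dominated_of_fderiv_le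
    (F' := fun q p => w p • eulerKernelDeriv b c q p) (bound := fun p => ‖w p‖ * C)
    (Metric.ball_mem_nhds q hε) ?_ (integrableOn_mul_eulerKernel hw b c hq) ?_ ?_
    (hw.norm.mul_const C) ?_
  · filter_upwards [isOpen_olssonDomain.mem_nhds hq] with q' hq'
    exact (integrableOn_mul_eulerKernel hw b c hq').aestronglyMeasurable
  · exact hw.aestronglyMeasurable.smul
      (aestronglyMeasurable_unitSquare_of_continuousOn (continuousOn_eulerKernelDeriv b c) hq)
  · refine (ae_restrict_iff' measurableSet_unitSquare).2 (.of_forall fun p hp q' hq' => ?_)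
    rw [norm_smul]
    gcongr
    exact hC q' hq' p (unitSquare_subset_closedUnitSquare hp)
  · refine (ae_restrict_iff' measurableSet_unitSquare).2 (.of_forall fun p hp q' hq' => ?_)
    have := hasFDerivAt_eulerKernel b c (hsub hq') (unitSquare_subset_closedUnitSquare hp)
    exact this.const_mul (w p)

lemma isOlssonFP_olssonEuler {a b c d e : ℂ} (hd : 0 < d.re) (hac : 0 < (a + c).re)
    (had : 0 < (a + d).re) (head : 0 < (e - a - d).re) :
    IsOlssonFP (a + c) b c e (c - d + 1) (olssonEuler a b c d e) :=
  ⟨(differentiableOn_integral_mul_eulerKernel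
    (integrableOn_betaWeight had head hac hd) b c).const_mul _,
    fun _ _ hx hy => hasSum_olssonTerm hd hac had head (q := (_, _)) hx hy⟩

/-! ### Uniqueness of the continuation. -/

/-- The identity theorem on a star-shaped domain of `ℂ`. -/
lemma eqOn_of_starConvex {U : Set ℂ} (hU : IsOpen U) {z₀ : ℂ} (hz₀ : z₀ ∈ U)
    (hs : StarConvex ℝ z₀ U) {f g : ℂ → ℂ} (hf : DifferentiableOn ℂ f U)
    (hg : DifferentiableOn ℂ g U) (h : ∀ z, ‖z₀ - z‖ < 1 → f z = g z) : Set.EqOn f g U := by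
  refine (hf.analyticOnNhd hU).eqOn_of_preconnected_of_eventuallyEq (hg.analyticOnNhd hU)
    (hs.isPathConnected hz₀).isConnected.isPreconnected hz₀ ?_
  filter_upwards [Metric.ball_mem_nhds z₀ one_pos] with z hz
  exact h z (by rwa [mem_ball_iff_norm'] at hz)

lemma isOlssonFP_unique {a b₁ b₂ c₁ c₂ : ℂ} {F G : ℂ × ℂ → ℂ}
    (hF : IsOlssonFP a b₁ b₂ c₁ c₂ F) (hG : IsOlssonFP a b₁ b₂ c₁ c₂ G) :
    Set.EqOn F G olssonDomain := by
  have hopen : IsOpen {z : ℂ | 1 - z ∈ Complex.slitPlane} :=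
    Complex.isOpen_slitPlane.preimage (by fun_prop)
  have hstar : StarConvex ℝ (0 : ℂ) {z : ℂ | 1 - z ∈ Complex.slitPlane} := by
    intro z hz s t hs ht hst
    have := one_sub_ofReal_mul_one_sub_mem_slitPlane hz ht (by linarith)
    simpa using this
  -- The one-variable identity theorem is used twice: in `x` with `y` fixed near `1`, and then in
  -- `y` with `x` arbitrary.
  have h1 (x y : ℂ) (hx : 1 - x ∈ Complex.slitPlane) (hy : ‖1 - y‖ < 1) : F (x, y) = G (x, y) := by
    have hy' : y ∈ Complex.slitPlane := by
      have := Complex.mem_slitPlane_of_norm_lt_one (z := y - 1) (by rwa [norm_sub_rev])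
      simpa using this
    have hmaps : Set.MapsTo (fun z : ℂ => (z, y)) {z : ℂ | 1 - z ∈ Complex.slitPlane}
        olssonDomain := fun z hz => (mem_olssonDomain_iff _).2 ⟨hz, hy'⟩
    exact eqOn_of_starConvex hopen (z₀ := 0) (by simp) hstar
      (hF.1.comp (f := fun z : ℂ => (z, y)) (by fun_prop) hmaps)
      (hG.1.comp (f := fun z : ℂ => (z, y)) (by fun_prop) hmaps)
      (fun z hz => (hF.2 z y (by simpa using hz) hy).unique (hG.2 z y (by simpa using hz) hy)) hx
  rintro ⟨x, y⟩ hq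
  obtain ⟨hx, hy⟩ := (mem_olssonDomain_iff _).1 hq
  have hmaps : Set.MapsTo (fun z : ℂ => (x, z)) Complex.slitPlane olssonDomain :=
    fun z hz => (mem_olssonDomain_iff _).2 ⟨hx, hz⟩
  exact eqOn_of_starConvex Complex.isOpen_slitPlane Complex.one_mem_slitPlane
    Complex.starConvex_one_slitPlane
    (hF.1.comp (f := fun z : ℂ => (x, z)) (by fun_prop) hmaps)
    (hG.1.comp (f := fun z : ℂ => (x, z)) (by fun_prop) hmaps) (fun z hz => h1 x z hx hz) hy

lemma isOlssonFP_olssonFP {a b₁ b₂ c₁ c₂ : ℂ} {F : ℂ × ℂ → ℂ} (hF : IsOlssonFP a b₁ b₂ c₁ c₂ F) :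
    IsOlssonFP a b₁ b₂ c₁ c₂ fun p => olssonFP a b₁ b₂ c₁ c₂ p.1 p.2 := by
  have h : ∃ F, IsOlssonFP a b₁ b₂ c₁ c₂ F := ⟨F, hF⟩
  simp only [olssonFP, dif_pos h]
  exact h.choose_spec

/-! ### Planar changes of variables and the three regions. -/

/-- Giving the four partial derivatives as functions makes the Jacobian the explicit `α δ - β γ`. -/
lemma changeOfVariables {S T : Set (ℝ × ℝ)} (hS : MeasurableSet S) {φ ψ α β γ δ : ℝ × ℝ → ℝ}
    (hφ : ∀ p ∈ S, HasFDerivAt φ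
      (α p • ContinuousLinearMap.fst ℝ ℝ ℝ + β p • ContinuousLinearMap.snd ℝ ℝ ℝ) p)
    (hψ : ∀ p ∈ S, HasFDerivAt ψ
      (γ p • ContinuousLinearMap.fst ℝ ℝ ℝ + δ p • ContinuousLinearMap.snd ℝ ℝ ℝ) p)
    (hbij : Set.BijOn (fun p => (φ p, ψ p)) S T) {f g : ℝ × ℝ → ℂ}
    (hfg : ∀ p ∈ S, f p = |α p * δ p - β p * γ p| • g (φ p, ψ p)) :
    (IntegrableOn g T ↔ IntegrableOn f S) ∧ ∫ p in T, g p = ∫ p in S, f p := by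
  let D : ℝ × ℝ → ℝ × ℝ →L[ℝ] ℝ × ℝ := fun p =>
    (Matrix.toLin (.finTwoProd ℝ) (.finTwoProd ℝ)
      !![α p, β p; γ p, δ p]).toContinuousLinearMap
  have hD : ∀ p ∈ S, HasFDerivWithinAt (fun p => (φ p, ψ p)) (D p) S p := by
    intro p hp
    simp only [D, Matrix.toLin_finTwoProd_toContinuousLinearMap]
    exact ((hφ p hp).prodMk (hψ p hp)).hasFDerivWithinAt
  have hdet (p) : (D p).det = α p * δ p - β p * γ p := by
    simp only [D, LinearMap.det_toContinuousLinearMap, LinearMap.det_toLin, Matrix.det_fin_two_of]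
  have h1 := integrableOn_image_iff_integrableOn_abs_det_fderiv_smul volume hS hD hbij.injOn g
  have h2 := integral_image_eq_integral_abs_det_fderiv_smul volume hS hD hbij.injOn g
  simp only [hdet] at h1 h2
  rw [hbij.image_eq] at h1 h2
  rw [h1, h2]
  exact ⟨integrableOn_congr_fun (fun p hp => (hfg p hp).symm) hS,
    setIntegral_congr_fun hS fun p hp => (hfg p hp).symm⟩

/-- The region below the graph of `g` over the open unit interval. -/
def regionBelow (g : ℝ → ℝ) : Set (ℝ × ℝ) :=
  {p | 0 < p.1 ∧ p.1 < 1 ∧ 0 < p.2 ∧ p.2 < g p.1}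

lemma measurableSet_regionBelow {g : ℝ → ℝ} (hg : Measurable g) :
    MeasurableSet (regionBelow g) :=
  (measurableSet_lt measurable_const measurable_fst).inter
    ((measurableSet_lt measurable_fst measurable_const).inter
      ((measurableSet_lt measurable_const measurable_snd).inter
        (measurableSet_lt measurable_snd (hg.comp measurable_fst))))

/-- Fubini for the indicator of the region. Nonnegativity of `g` matters because an interval
integral changes sign when its endpoints are reversed. -/
lemma setIntegral_regionBelow {g : ℝ → ℝ} (hg : Measurable g)
    (h0 : ∀ u ∈ Set.Ioo (0 : ℝ) 1, 0 ≤ g u) {f : ℝ → ℝ → ℂ}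
    (hf : IntegrableOn (fun p : ℝ × ℝ => f p.1 p.2) (regionBelow g)) :
    ∫ p in regionBelow g, f p.1 p.2 = ∫ u in (0 : ℝ)..1, ∫ v in (0 : ℝ)..(g u), f u v := by
  have hm := measurableSet_regionBelow hg
  rw [← integral_indicator hm, Measure.volume_eq_prod, integral_prod _ (by
    rw [← Measure.volume_eq_prod]; exact hf.integrable_indicator hm),
    intervalIntegral.integral_of_le zero_le_one, integral_Ioc_eq_integral_Ioo,
    ← integral_indicator measurableSet_Ioo]
  congr 1
  funext u
  by_cases hu : u ∈ Set.Ioo (0 : ℝ) 1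
  · rw [Set.indicator_of_mem hu, intervalIntegral.integral_of_le (h0 u hu),
      integral_Ioc_eq_integral_Ioo, ← integral_indicator measurableSet_Ioo]
    congr 1
    funext v
    by_cases hv : v ∈ Set.Ioo 0 (g u)
    · rw [Set.indicator_of_mem hv, Set.indicator_of_mem (show (u, v) ∈ regionBelow g from
        ⟨hu.1, hu.2, hv.1, hv.2⟩)]
    · rw [Set.indicator_of_notMem hv, Set.indicator_of_notMem fun h => hv ⟨h.2.2.1, h.2.2.2⟩]
  · rw [Set.indicator_of_notMem hu]
    refine integral_eq_zero_of_ae (.of_forall fun v => ?_)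
    exact Set.indicator_of_notMem (fun h => hu ⟨h.1, h.2.1⟩) _

lemma bijOn_simplex_coordinates :
    Set.BijOn (fun p : ℝ × ℝ => (p.1 * p.2, p.1 * (1 - p.2))) unitSquare
      (regionBelow fun u => 1 - u) := by
  refine ⟨?_, ?_, ?_⟩
  · rintro ⟨s, t⟩ ⟨h1, h2, h3, h4⟩
    refine ⟨?_, ?_, ?_, ?_⟩ <;> dsimp at * <;> nlinarith
  · rintro ⟨s, t⟩ ⟨h1, h2, h3, h4⟩ ⟨s', t'⟩ ⟨h1', h2', h3', h4'⟩ h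
    simp only [Prod.mk.injEq] at h ⊢
    obtain ⟨e1, e2⟩ := h
    have hs : s = s' := by linarith
    subst hs
    exact ⟨rfl, mul_left_cancel₀ (ne_of_gt h1) e1⟩
  · rintro ⟨u, v⟩ ⟨h1, h2, h3, h4⟩
    dsimp at h1 h2 h3 h4
    have hpos : 0 < u + v := by linarith
    -- The inverse of `u = st`, `v = s(1-t)` is `s = u + v`, `t = u / (u + v)`.
    refine ⟨(u + v, u / (u + v)), ⟨hpos, by dsimp; linarith, by dsimp; positivity, ?_⟩, ?_⟩
    · dsimp
      rw [div_lt_one hpos]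
      linarith
    · ext <;> dsimp <;> field_simp
      ring

lemma bijOn_hyperbola :
    Set.BijOn (fun p : ℝ × ℝ => (p.1, p.1 * p.2)) (regionBelow fun u => u⁻¹ - 1)
      (regionBelow fun u => 1 - u) := by
  refine ⟨?_, ?_, ?_⟩
  · rintro ⟨u, v⟩ ⟨h1, h2, h3, h4⟩
    dsimp at h1 h2 h3 h4
    refine ⟨h1, h2, mul_pos h1 h3, ?_⟩
    have := mul_lt_mul_of_pos_left h4 h1
    rwa [mul_sub, mul_inv_cancel₀ h1.ne', mul_one] at this
  · rintro ⟨u, v⟩ ⟨h1, -⟩ ⟨u', v'⟩ - h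
    simp only [Prod.mk.injEq] at h ⊢
    obtain ⟨rfl, e2⟩ := h
    exact ⟨rfl, mul_left_cancel₀ (ne_of_gt h1) e2⟩
  · rintro ⟨u, v⟩ ⟨h1, h2, h3, h4⟩
    dsimp at h1 h2 h3 h4
    refine ⟨(u, v / u), ⟨h1, h2, div_pos h3 h1, ?_⟩, ?_⟩
    · dsimp
      rw [div_lt_iff₀ h1, sub_mul, inv_mul_cancel₀ h1.ne', one_mul]
      exact h4
    · ext
      · rfl
      · exact mul_div_cancel₀ _ h1.ne'

lemma bijOn_square :
    Set.BijOn (fun p : ℝ × ℝ => (p.1, (1 - p.1) * p.2)) unitSquare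
      (regionBelow fun u => 1 - u) := by
  refine ⟨?_, ?_, ?_⟩
  · rintro ⟨u, v⟩ ⟨h1, h2, h3, h4⟩
    exact ⟨h1, h2, mul_pos (sub_pos.2 h2) h3, mul_lt_of_lt_one_right (sub_pos.2 h2) h4⟩
  · rintro ⟨u, v⟩ ⟨-, h2, -⟩ ⟨u', v'⟩ - h
    simp only [Prod.mk.injEq] at h ⊢
    obtain ⟨rfl, e2⟩ := h
    exact ⟨rfl, mul_left_cancel₀ (sub_pos.2 h2).ne' e2⟩
  · rintro ⟨u, v⟩ ⟨h1, h2, h3, h4⟩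
    have h : 0 < 1 - u := sub_pos.2 h2
    refine ⟨(u, v / (1 - u)), ⟨h1, h2, div_pos h3 h, (div_lt_one h).2 h4⟩, ?_⟩
    ext
    · rfl
    · exact mul_div_cancel₀ _ h.ne'

/-! ### Principal powers of products. -/

lemma mul_cpow_of_arg_add_mem {z w : ℂ} (hz : z ≠ 0) (hw : w ≠ 0)
    (h : z.arg + w.arg ∈ Set.Ioc (-Real.pi) Real.pi) (s : ℂ) :
    (z * w) ^ s = z ^ s * w ^ s := by
  rw [Complex.cpow_def_of_ne_zero (mul_ne_zero hz hw), Complex.cpow_def_of_ne_zero hz,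
    Complex.cpow_def_of_ne_zero hw, Complex.log_mul hz hw h, add_mul, Complex.exp_add]

lemma ofReal_mul_cpow {t : ℝ} (ht : 0 < t) {w : ℂ} (hw : w ≠ 0) (s : ℂ) :
    ((t : ℂ) * w) ^ s = (t : ℂ) ^ s * w ^ s :=
  mul_cpow_of_arg_add_mem (by exact_mod_cast ht.ne') hw
    (by rw [Complex.arg_ofReal_of_nonneg ht.le, zero_add]; exact Complex.arg_mem_Ioc w) s

/-- One argument lies in `[0, π]` and the other in `(-π, 0]`. Membership in the slit plane excludes
argument `π` for `w` when its imaginary part vanishes. -/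
lemma arg_add_arg_mem_of_im {z w : ℂ} (hw : w ∈ Complex.slitPlane)
    (h1 : 0 ≤ z.im) (h2 : w.im ≤ 0) : z.arg + w.arg ∈ Set.Ioc (-Real.pi) Real.pi := by
  have hz := Complex.arg_nonneg_iff.2 h1
  have hw' : w.arg ≤ 0 := by
    rcases h2.lt_or_eq with h | h
    · exact (Complex.arg_neg_iff.2 h).le
    · rw [Complex.arg_eq_zero_iff.2 ⟨?_, h⟩]
      rcases hw with hw | hw
      · exact hw.le
      · exact absurd h hw
  exact ⟨by linarith [Complex.neg_pi_lt_arg w], by linarith [Complex.arg_le_pi z]⟩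

lemma neg_inv_mem_slitPlane {y : ℂ} (hy : -y ∈ Complex.slitPlane) :
    -y⁻¹ ∈ Complex.slitPlane := by
  have h0 := Complex.normSq_pos.2 (Complex.slitPlane_ne_zero hy)
  rw [← inv_neg, Complex.mem_slitPlane_iff, Complex.inv_re, Complex.inv_im]
  exact hy.imp (div_pos · h0) fun h => div_ne_zero (neg_ne_zero.2 h) h0.ne'

/-- The imaginary part of `1 - t(1 + 1/y)` is `t · Im y / |y|²`, of sign opposite to that of `-y`.
Hence the arguments of the two bases add without leaving `(-π, π]`, and the principal powers
multiply. -/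
lemma neg_cpow_mul_cpow {y : ℂ} (hy : -y ∈ Complex.slitPlane) {t : ℝ} (h0 : 0 < t) (h1 : t < 1)
    (c : ℂ) : (-y) ^ (-c) * (1 - (t : ℂ) * (1 - -y⁻¹)) ^ (-c) =
      (t : ℂ) ^ (-c) * (1 - (t : ℂ)⁻¹ * (1 - t) * y) ^ (-c) := by
  have hz := Complex.slitPlane_ne_zero hy
  have hy0 : y ≠ 0 := neg_ne_zero.1 hz
  have ht : (t : ℂ) ≠ 0 := by exact_mod_cast h0.ne'
  have hinv := neg_inv_mem_slitPlane hy
  have hB := one_sub_ofReal_mul_one_sub_mem_slitPlane hinv h0.le h1.le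
  have hB0 := Complex.slitPlane_ne_zero hB
  have heq : -y * (1 - (t : ℂ) * (1 - -y⁻¹)) = t * (1 - (t : ℂ)⁻¹ * (1 - t) * y) := by
    field_simp
    ring
  have hW : 1 - (t : ℂ)⁻¹ * (1 - t) * y ≠ 0 := fun h => by
    rw [h, mul_zero] at heq
    exact mul_ne_zero hz hB0 heq
  rw [← ofReal_mul_cpow h0 hW, ← heq, mul_cpow_of_arg_add_mem hz hB0]
  have him : (1 - (t : ℂ) * (1 - -y⁻¹)).im = t * y.im / Complex.normSq y := by
    simp [Complex.inv_im]
    ring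
  have hn := Complex.normSq_nonneg y
  rcases le_total y.im 0 with h | h
  · refine arg_add_arg_mem_of_im hB (by simpa using h) ?_
    rw [him]
    exact div_nonpos_of_nonpos_of_nonneg (mul_nonpos_of_nonneg_of_nonpos h0.le h) hn
  · rw [add_comm]
    refine arg_add_arg_mem_of_im hy ?_ (by simpa using h)
    rw [him]
    positivity

lemma hasFDerivAt_of_eq {φ : ℝ × ℝ → ℝ} {φ' L : ℝ × ℝ →L[ℝ] ℝ} {p : ℝ × ℝ}
    (h : HasFDerivAt φ φ' p) (h' : ∀ z, φ' z = L z) : HasFDerivAt φ L p :=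
  h.congr_fderiv (ContinuousLinearMap.ext h')

lemma ofReal_mul_cpow_sub_one {t : ℝ} (ht : t ≠ 0) (s : ℂ) :
    (t : ℂ) * (t : ℂ) ^ (s - 1) = (t : ℂ) ^ s := by
  have h : (t : ℂ) ≠ 0 := by exact_mod_cast ht
  rw [Complex.cpow_sub _ _ h, Complex.cpow_one, mul_div_cancel₀ _ h]

/-! ### Matching the integrands and the integrals. -/

/-- In these coordinates `1 - u - v = 1 - s` and `v / u = (1 - t) / t`, while `t^(-c)` from
`neg_cpow_mul_cpow` lowers `t^(a+c-1)` to `t^(a-1)`. The factor `s` is the absolute Jacobian. -/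
lemma triangleIntegrand_simplex_coordinates (a b c d e x : ℂ) {y : ℂ}
    (hy : -y ∈ Complex.slitPlane) {p : ℝ × ℝ} (hp : p ∈ unitSquare) :
    (-y) ^ (-c) *
        (betaWeight (a + d) (e - a - d) (a + c) d p * eulerKernel b c (x, -y⁻¹) p) =
      (p.1 : ℂ) * triangleIntegrand a b c d e x y (p.1 * p.2) (p.1 * (1 - p.2)) := by
  obtain ⟨s, t⟩ := p
  obtain ⟨h1, h2, h3, h4⟩ := hp
  dsimp only at h1 h2 h3 h4
  have hs : (s : ℂ) ≠ 0 := by exact_mod_cast h1.ne'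
  have ht : (t : ℂ) ≠ 0 := by exact_mod_cast h3.ne'
  have key := neg_cpow_mul_cpow hy h3 h4 c
  have e1 : ((s * t : ℝ) : ℂ) ^ (a - 1) = (s : ℂ) ^ (a - 1) * (t : ℂ) ^ (a - 1) := by
    rw [Complex.ofReal_mul, Complex.mul_cpow_ofReal_nonneg h1.le h3.le]
  have e2 : ((s * (1 - t) : ℝ) : ℂ) ^ (d - 1) = (s : ℂ) ^ (d - 1) * (1 - (t : ℂ)) ^ (d - 1) := by
    rw [Complex.ofReal_mul, Complex.mul_cpow_ofReal_nonneg h1.le (sub_pos.2 h4).le]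
    push_cast
    rfl
  have e3 : 1 - ((s * t : ℝ) : ℂ)⁻¹ * ((s * (1 - t) : ℝ) : ℂ) * y =
      1 - (t : ℂ)⁻¹ * (1 - t) * y := by
    push_cast
    field_simp
  have e4 : 1 - ((s * t : ℝ) : ℂ) - ((s * (1 - t) : ℝ) : ℂ) = 1 - s := by
    push_cast
    ring
  have e5 : (s : ℂ) ^ (a + d - 1) = s * (s : ℂ) ^ (a - 1) * (s : ℂ) ^ (d - 1) := by
    rw [ofReal_mul_cpow_sub_one h1.ne', ← Complex.cpow_add _ _ hs, add_sub_assoc]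
  have e6 : (t : ℂ) ^ (a + c - 1) * (t : ℂ) ^ (-c) = (t : ℂ) ^ (a - 1) := by
    rw [← Complex.cpow_add _ _ ht]
    congr 1
    ring
  rw [triangleIntegrand, e1, e2, e3, e4, betaWeight, betaDensity, betaDensity, eulerKernel, e5,
    ← e6, Complex.ofReal_mul]
  dsimp only
  -- The coefficient collects the factors common to both sides, leaving the branch identity `key`.
  linear_combination (s * (s : ℂ) ^ (a - 1) * (s : ℂ) ^ (d - 1) *
    (1 - (s : ℂ)) ^ (e - a - d - 1) * (t : ℂ) ^ (a + c - 1) * (1 - (t : ℂ)) ^ (d - 1) *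
    (1 - (s : ℂ) * t * x) ^ (-b)) * key

/-- The Jacobian `u` and the `u^(d-1)` split off from `(uv)^(d-1)` raise `u^(a-1)` to `u^(a+d-1)`.
-/
lemma hyperbolaIntegrand_eq (a b c d e x y : ℂ) {p : ℝ × ℝ}
    (hp : p ∈ regionBelow fun u => u⁻¹ - 1) :
    hyperbolaIntegrand a b c d e x y p.1 p.2 =
      (p.1 : ℂ) * triangleIntegrand a b c d e x y p.1 (p.1 * p.2) := by
  obtain ⟨u, v⟩ := p
  obtain ⟨h1, h2, h3, h4⟩ := hp
  dsimp only at h1 h2 h3 h4 ⊢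
  have hu : (u : ℂ) ≠ 0 := by exact_mod_cast h1.ne'
  have e1 : (u : ℂ) ^ (a + d - 1) = u * (u : ℂ) ^ (a - 1) * (u : ℂ) ^ (d - 1) := by
    rw [ofReal_mul_cpow_sub_one h1.ne', ← Complex.cpow_add _ _ hu, add_sub_assoc]
  rw [triangleIntegrand, hyperbolaIntegrand, e1, Complex.ofReal_mul,
    Complex.mul_cpow_ofReal_nonneg h1.le h3.le, inv_mul_cancel_left₀ hu]
  ring

/-- Since `1 - u - (1-u)v = (1-u)(1-v)`, the powers of `1 - u`, Jacobian included, combine to the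
exponent `e - a - 1`. -/
lemma squareIntegrand_eq (a b c d e x y : ℂ) {p : ℝ × ℝ} (hp : p ∈ unitSquare) :
    squareIntegrand a b c d e x y p.1 p.2 =
      ((1 - p.1 : ℝ) : ℂ) * triangleIntegrand a b c d e x y p.1 ((1 - p.1) * p.2) := by
  obtain ⟨u, v⟩ := p
  obtain ⟨h1, h2, h3, h4⟩ := hp
  dsimp only at h1 h2 h3 h4 ⊢
  have h5 : 0 < 1 - u := sub_pos.2 h2
  have hu : ((1 - u : ℝ) : ℂ) ≠ 0 := by exact_mod_cast h5.ne'
  have e1 : ((1 - u : ℝ) : ℂ) ^ (e - a - 1) = ((1 - u : ℝ) : ℂ) *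
      ((1 - u : ℝ) : ℂ) ^ (d - 1) * ((1 - u : ℝ) : ℂ) ^ (e - a - d - 1) := by
    rw [ofReal_mul_cpow_sub_one h5.ne', ← Complex.cpow_add _ _ hu]
    congr 1
    ring
  have e2 : 1 - (u : ℂ) - (((1 - u) * v : ℝ) : ℂ) = ((1 - u : ℝ) : ℂ) * ((1 - v : ℝ) : ℂ) := by
    push_cast
    ring
  have e3 : 1 - (u : ℂ) = ((1 - u : ℝ) : ℂ) := by push_cast; rfl
  rw [triangleIntegrand, squareIntegrand, e2, Complex.mul_cpow_ofReal_nonneg h5.le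
    (sub_pos.2 h4).le, Complex.ofReal_mul, Complex.mul_cpow_ofReal_nonneg h5.le h3.le, e3, e1]
  push_cast
  ring_nf

lemma measurableSet_hyperbola : MeasurableSet (regionBelow fun u => u⁻¹ - 1) :=
  measurableSet_regionBelow (by fun_prop)

lemma integral_triangle_eq_euler (a b c d e x : ℂ) {y : ℂ} (hy : -y ∈ Complex.slitPlane) :
    (IntegrableOn (fun p : ℝ × ℝ => triangleIntegrand a b c d e x y p.1 p.2)
        (regionBelow fun u => 1 - u) ↔
      IntegrableOn (fun p => (-y) ^ (-c) *
        (betaWeight (a + d) (e - a - d) (a + c) d p * eulerKernel b c (x, -y⁻¹) p)) unitSquare) ∧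
    ∫ p in regionBelow fun u => 1 - u, triangleIntegrand a b c d e x y p.1 p.2 =
      ∫ p in unitSquare, (-y) ^ (-c) *
        (betaWeight (a + d) (e - a - d) (a + c) d p * eulerKernel b c (x, -y⁻¹) p) := by
  refine changeOfVariables (α := Prod.snd) (β := Prod.fst) (γ := fun p => 1 - p.2)
    (δ := fun p => -p.1) measurableSet_unitSquare
    (fun p _ => hasFDerivAt_of_eq (hasFDerivAt_fst.mul hasFDerivAt_snd) fun z => ?_)
    (fun p _ => hasFDerivAt_of_eq (hasFDerivAt_fst.mul (hasFDerivAt_snd.const_sub 1)) fun z => ?_)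
    bijOn_simplex_coordinates fun p hp => ?_
  · simp
    ring
  · simp
    ring
  · rw [triangleIntegrand_simplex_coordinates a b c d e x hy hp,
      show p.2 * -p.1 - p.1 * (1 - p.2) = -p.1 by ring, abs_neg, abs_of_pos hp.1,
      Complex.real_smul]
    rfl

lemma integral_triangle_eq_hyperbola (a b c d e x y : ℂ) :
    (IntegrableOn (fun p : ℝ × ℝ => triangleIntegrand a b c d e x y p.1 p.2)
        (regionBelow fun u => 1 - u) ↔
      IntegrableOn (fun p : ℝ × ℝ => hyperbolaIntegrand a b c d e x y p.1 p.2)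
        (regionBelow fun u => u⁻¹ - 1)) ∧
    ∫ p in regionBelow fun u => 1 - u, triangleIntegrand a b c d e x y p.1 p.2 =
      ∫ p in regionBelow fun u => u⁻¹ - 1, hyperbolaIntegrand a b c d e x y p.1 p.2 := by
  refine changeOfVariables (α := fun _ => 1) (β := fun _ => 0) (γ := Prod.snd)
    (δ := Prod.fst) measurableSet_hyperbola
    (fun p _ => hasFDerivAt_of_eq hasFDerivAt_fst fun z => ?_)
    (fun p _ => hasFDerivAt_of_eq (hasFDerivAt_fst.mul hasFDerivAt_snd) fun z => ?_)
    bijOn_hyperbola fun p hp => ?_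
  · simp
  · simp
    ring
  · rw [hyperbolaIntegrand_eq a b c d e x y hp, one_mul, zero_mul, sub_zero, abs_of_pos hp.1,
      Complex.real_smul]
    rfl

lemma integral_triangle_eq_square (a b c d e x y : ℂ) :
    (IntegrableOn (fun p : ℝ × ℝ => triangleIntegrand a b c d e x y p.1 p.2)
        (regionBelow fun u => 1 - u) ↔
      IntegrableOn (fun p : ℝ × ℝ => squareIntegrand a b c d e x y p.1 p.2) unitSquare) ∧
    ∫ p in regionBelow fun u => 1 - u, triangleIntegrand a b c d e x y p.1 p.2 =
      ∫ p in unitSquare, squareIntegrand a b c d e x y p.1 p.2 := by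
  refine changeOfVariables (α := fun _ => 1) (β := fun _ => 0) (γ := fun p => -p.2)
    (δ := fun p => 1 - p.1) measurableSet_unitSquare
    (fun p _ => hasFDerivAt_of_eq hasFDerivAt_fst fun z => ?_)
    (fun p _ => hasFDerivAt_of_eq ((hasFDerivAt_fst.const_sub 1).mul hasFDerivAt_snd) fun z => ?_)
    bijOn_square fun p hp => ?_
  · simp
  · simp
    ring
  · rw [squareIntegrand_eq a b c d e x y hp, one_mul, zero_mul, sub_zero,
      abs_of_pos (sub_pos.2 hp.2.1), Complex.real_smul]
    rfl

theorem mainTheorem8 (a b c d e x y : ℂ)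
    (ha : 0 < a.re) (hd : 0 < d.re) (hac : 0 < (a + c).re) (had : 0 < (a + d).re)
    (head : 0 < (e - a - d).re)
    (hx : x ∉ Complex.ofReal '' Set.Ici (1 : ℝ)) (hy : y ∉ Complex.ofReal '' Set.Ici (0 : ℝ)) :
    -- the analytic continuation defining `F_P` exists for these parameters
    IsOlssonFP (a + c) b c e (c - d + 1)
      (fun p => olssonFP (a + c) b c e (c - d + 1) p.1 p.2) ∧
    -- the three double integrals converge absolutely
    IntegrableOn (fun p : ℝ × ℝ => squareIntegrand a b c d e x y p.1 p.2)
      {p : ℝ × ℝ | 0 < p.1 ∧ p.1 < 1 ∧ 0 < p.2 ∧ p.2 < 1} ∧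
    IntegrableOn (fun p : ℝ × ℝ => hyperbolaIntegrand a b c d e x y p.1 p.2)
      {p : ℝ × ℝ | 0 < p.1 ∧ p.1 < 1 ∧ 0 < p.2 ∧ p.2 < p.1⁻¹ - 1} ∧
    IntegrableOn (fun p : ℝ × ℝ => triangleIntegrand a b c d e x y p.1 p.2)
      {p : ℝ × ℝ | 0 < p.1 ∧ p.1 < 1 ∧ 0 < p.2 ∧ p.2 < 1 - p.1} ∧
    -- the integral over the square
    Complex.Gamma (a + c) * Complex.Gamma (a + d) /
          (Complex.Gamma (a + c + d) * Complex.Gamma a) *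
        (-y) ^ (-c) * olssonFP (a + c) b c e (c - d + 1) x (-y⁻¹) =
      Complex.Gamma e / (Complex.Gamma (e - a - d) * Complex.Gamma a * Complex.Gamma d) *
        ∫ p in {p : ℝ × ℝ | 0 < p.1 ∧ p.1 < 1 ∧ 0 < p.2 ∧ p.2 < 1},
          squareIntegrand a b c d e x y p.1 p.2 ∧
    -- the integral over the region bounded by a hyperbola
    Complex.Gamma (a + c) * Complex.Gamma (a + d) /
          (Complex.Gamma (a + c + d) * Complex.Gamma a) *
        (-y) ^ (-c) * olssonFP (a + c) b c e (c - d + 1) x (-y⁻¹) =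
      Complex.Gamma e / (Complex.Gamma (e - a - d) * Complex.Gamma a * Complex.Gamma d) *
        ∫ u in (0 : ℝ)..1, ∫ v in (0 : ℝ)..(u⁻¹ - 1), hyperbolaIntegrand a b c d e x y u v ∧
    -- the integral over the triangle
    Complex.Gamma (a + c) * Complex.Gamma (a + d) /
          (Complex.Gamma (a + c + d) * Complex.Gamma a) *
        (-y) ^ (-c) * olssonFP (a + c) b c e (c - d + 1) x (-y⁻¹) =
      Complex.Gamma e / (Complex.Gamma (e - a - d) * Complex.Gamma a * Complex.Gamma d) *
        ∫ u in (0 : ℝ)..1, ∫ v in (0 : ℝ)..(1 - u), triangleIntegrand a b c d e x y u v := by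
  have hyn : -y ∈ Complex.slitPlane := by
    rw [Complex.mem_slitPlane_iff_not_le_zero, Complex.le_def]
    rintro ⟨h1, h2⟩
    simp only [Complex.neg_re, Complex.neg_im, Complex.zero_re, Complex.zero_im] at h1 h2
    exact hy ⟨y.re, by simpa using h1, Complex.ext rfl (by simp [neg_eq_zero.1 h2])⟩
  have hq : (x, -y⁻¹) ∈ olssonDomain :=
    ⟨hx, ((mem_olssonDomain_iff (0, -y⁻¹)).2 ⟨by simp, neg_inv_mem_slitPlane hyn⟩).2⟩
  have hE := isOlssonFP_olssonEuler (b := b) hd hac had head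
  have hF := isOlssonFP_olssonFP hE
  have hval : olssonFP (a + c) b c e (c - d + 1) x (-y⁻¹) = olssonEuler a b c d e (x, -y⁻¹) :=
    isOlssonFP_unique hF hE hq
  obtain ⟨hi1, hv1⟩ := integral_triangle_eq_euler a b c d e x hyn
  obtain ⟨hi2, hv2⟩ := integral_triangle_eq_hyperbola a b c d e x y
  obtain ⟨hi3, hv3⟩ := integral_triangle_eq_square a b c d e x y
  -- Integrability is known for the Euler integrand, passes to the triangle, and from there reaches
  -- the other two regions.
  have hT := hi1.2
    ((integrableOn_mul_eulerKernel (integrableOn_betaWeight had head hac hd) b c hq).const_mul _)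
  have hmain : Complex.Gamma (a + c) * Complex.Gamma (a + d) /
          (Complex.Gamma (a + c + d) * Complex.Gamma a) *
        (-y) ^ (-c) * olssonFP (a + c) b c e (c - d + 1) x (-y⁻¹) =
      Complex.Gamma e / (Complex.Gamma (e - a - d) * Complex.Gamma a * Complex.Gamma d) *
        ∫ p in regionBelow fun u => 1 - u, triangleIntegrand a b c d e x y p.1 p.2 := by
    have h2 := Complex.Gamma_ne_zero_of_re_pos hac
    have h3 := Complex.Gamma_ne_zero_of_re_pos had
    have h4 : Complex.Gamma (a + c + d) ≠ 0 :=
      Complex.Gamma_ne_zero_of_re_pos (by simpa using add_pos hac hd)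
    rw [hval, hv1, integral_const_mul, olssonEuler, eulerConst]
    field_simp
  refine ⟨hF, hi3.1 hT, hi2.1 hT, hT, ?_, ?_, ?_⟩
  · rw [hmain, hv3]
    rfl
  · rw [hmain, hv2, setIntegral_regionBelow (by fun_prop) _ (hi2.1 hT)]
    exact fun u hu => sub_nonneg.2 ((one_le_inv₀ hu.1).2 hu.2.le)
  · rw [hmain, setIntegral_regionBelow (by fun_prop) _ hT]
    exact fun u hu => sub_nonneg.2 hu.2.le
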